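/- Let $\Phi:[0,\infty)\to[0,\infty)$ be a Young function, i.e. $\Phi$ is convex, $\Phi(t)=0$ if and only if $t=0$, $\Phi(t)/t\to0$ as $t\to0^+$ and $\Phi(t)/t\to+\infty$ as $t\to+\infty$. Assume that $\Phi$ is of class $C^2$ on $(0,\infty)$ and, with $\phi:=\Phi'$, that $$0<\inf_{t>0}\frac{t\phi'(t)}{\phi(t)}\le\sup_{t>0}\frac{t\phi'(t)}{\phi(t)}<+\infty,\qquad \sup_{t>0}\frac{t\Phi'(t)}{\Phi(t)}<N .$$ Extend $\phi$ to an odd function on $\mathbb{R}$ and let $\phi^{-1}:\mathbb{R}\to\mathbb{R}$ be its inverse. Write $\Delta_\Phi u:=\operatorname{div}\left(\phi(|\nabla u|)\frac{\nabla u}{|\nabla u|}\right)$, where the vector field is $0$ at points where $\nabla u=0$; equations are understood in the sense of distributions. Let $B_r$ be the open ball of $\mathbb{R}^N$ of radius $r$ centred at the origin and $B_r^e:=\mathbb{R}^N\setminus\overline{B}_r$. Let $\mathcal{D}^{1,\Phi}_0(B_r^e)$ be the closure of the restrictions to $B_r^e$ of functions in $C^\infty_c(\mathbb{R}^N)$ under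 the Luxemburg norm $\|\nabla u\|_{L^\Phi(B_r^e)}$, its elements being identified with the $L^1_{\rm loc}(B_r^e)$-limits of the approximating sequences. Let $c,\mu,r>0$ and $l>N$ satisfy $$c>\int_r^{+\infty}\phi^{-1}\left(\frac{\mu}{l-N}\,\tau^{1-l}\right)d\tau .$$ Then, for each of the two choices $\nu=\mu$ and $\nu=-\mu$, there is $\overline w\in C^1(\mathbb{R}^N\setminus\{0\})$ with $\overline w|_{B_r^e}\in\mathcal{D}^{1,\Phi}_0(B_r^e)$ and $$-\Delta_\Phi\overline w=\nu|x|^{-l}\ \text{ in }\mathbb{R}^N\setminus\{0\},\qquad \overline w=c\ \text{ on }\partial B_r,\qquad \overline w(x)\to0\ \text{ as }|x|\to+\infty .$$ Moreover, there is $k>0$ such that, for all $x\ne0$, $$\overline w(x)=\int_{|x|}^{+\infty}\phi^{-1}\left(\frac{\nu}{N-l}\,\rho^{1-l}+k\,\rho^{1-N}\right)d\rho ,$$ where the integral converges absolutely. For given $\Phi,N,r,l,\nu$, this $k$ is determined by $c$: it is the only $k>0$ for which $\int_r^{+\infty}\phi^{-1}\left(\frac{\nu}{N-l}\rho^{1-l}+k\rho^{1-N}\right)d\rho=c$.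 (The case $\nu=\mu$ is $-\Delta_\Phi\overline w=\mu|x|^{-l}$. The case $\nu=-\mu$, with coefficient $\frac{\mu}{l-N}$ in the formula, is $\operatorname{div}\left(\phi(|\nabla\overline w|)\frac{\nabla\overline w}{|\nabla\overline w|}\right)=\mu|x|^{-l}$, which is the same problem under the convention that the divergence itself is denoted by $-\Delta_\Phi\overline w$.) -/

import Mathlib

open MeasureTheory Set Filter Topology
open scoped ContDiff ENNReal

/-- A Young function `Φ : [0,∞) → [0,∞)`, coded as `Φ : ℝ → ℝ`; only the values of `Φ` on
`[0,∞)` matter. -/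
structure IsYoungFunction (Φ : ℝ → ℝ) : Prop where
  convexOn : ConvexOn ℝ (Ici 0) Φ
  nonneg : ∀ t, 0 ≤ t → 0 ≤ Φ t
  eq_zero_iff : ∀ t, 0 ≤ t → (Φ t = 0 ↔ t = 0)
  tendsto_zero : Tendsto (fun t => Φ t / t) (𝓝[>] 0) (𝓝 0)
  tendsto_atTop : Tendsto (fun t => Φ t / t) atTop atTop

/-- The lower index `inf_{t>0} t g'(t) / g(t)`, as an extended real number. -/
noncomputable def lowerIndex (g : ℝ → ℝ) : EReal :=
  ⨅ t : Ioi (0 : ℝ), (((t : ℝ) * deriv g t / g t : ℝ) : EReal)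

/-- The upper index `sup_{t>0} t g'(t) / g(t)`, as an extended real number. -/
noncomputable def upperIndex (g : ℝ → ℝ) : EReal :=
  ⨆ t : Ioi (0 : ℝ), (((t : ℝ) * deriv g t / g t : ℝ) : EReal)

/-- The ellipticity hypothesis in dimension `N` on the Young function `Φ`, with `φ = Φ'`:
`Φ` is of class `C²` on `(0,∞)`, `0 < i_φ ≤ s_φ < ∞` and `s_Φ < N`. -/
structure IsElliptic (N : ℕ) (Φ : ℝ → ℝ) : Prop where
  young : IsYoungFunction Φ
  contDiffOn : ContDiffOn ℝ 2 Φ (Ioi 0)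
  lower_pos : 0 < lowerIndex (deriv Φ)
  upper_lt_top : upperIndex (deriv Φ) < ⊤
  upper_lt_dim : upperIndex Φ < ((N : ℝ) : EReal)

/-- The odd extension of `φ = Φ'` from `(0,∞)` to `ℝ`. -/
noncomputable def oddPhi (Φ : ℝ → ℝ) (t : ℝ) : ℝ := Real.sign t * deriv Φ |t|

/-- `φ⁻¹`, the inverse of the odd extension of `φ = Φ'`. Under the ellipticity hypothesis that
extension is a bijection of `ℝ`, and on `(0,∞)` this is the inverse of `φ : (0,∞) → (0,∞)`. -/
noncomputable def phiInv (Φ : ℝ → ℝ) : ℝ → ℝ := Function.invFun (oddPhi Φ)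

section Spaces

variable {N : ℕ} {F : Type*} [NormedAddCommGroup F]

/-- Membership in the Orlicz class `L^Φ(Ω)`. -/
def MemOrlicz (Φ : ℝ → ℝ) (Ω : Set (EuclideanSpace ℝ (Fin N)))
    (f : EuclideanSpace ℝ (Fin N) → F) : Prop :=
  AEStronglyMeasurable f (volume.restrict Ω) ∧ ∫⁻ x in Ω, ENNReal.ofReal (Φ ‖f x‖) < ⊤

/-- The Luxemburg norm on `L^Φ(Ω)`, with the value `∞` if no `τ > 0` is admissible. -/
noncomputable def luxemburgNorm (Φ : ℝ → ℝ) (Ω : Set (EuclideanSpace ℝ (Fin N)))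
    (f : EuclideanSpace ℝ (Fin N) → F) : ℝ≥0∞ :=
  ⨅ (τ : ℝ) (_ : 0 < τ) (_ : ∫⁻ x in Ω, ENNReal.ofReal (Φ (‖f x‖ / τ)) ≤ 1), ENNReal.ofReal τ

/-- `G` is the weak gradient of `u` in the open set `Ω`. -/
def HasWeakGradientOn (u : EuclideanSpace ℝ (Fin N) → ℝ)
    (G : EuclideanSpace ℝ (Fin N) → EuclideanSpace ℝ (Fin N))
    (Ω : Set (EuclideanSpace ℝ (Fin N))) : Prop :=
  LocallyIntegrableOn u Ω ∧ LocallyIntegrableOn G Ω ∧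
    ∀ ξ : EuclideanSpace ℝ (Fin N) → ℝ, ContDiff ℝ ∞ ξ → HasCompactSupport ξ → tsupport ξ ⊆ Ω →
      ∀ e : EuclideanSpace ℝ (Fin N),
        ∫ x, u x * fderiv ℝ ξ x e = - ∫ x, inner ℝ (G x) e * ξ x

/-- `u|_Ω ∈ D^{1,Φ}_0(Ω)`, the closure of (the restrictions to `Ω` of) `C^∞_c(ℝ^N)` under the norm
`‖∇u‖_{L^Φ(Ω)}`. An element of the completion is identified with the function that is the limit in
`L¹_loc(Ω)` of the approximating sequence. The approximating functions need not vanish on `∂Ω`. -/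
def MemBeppoLeviOrlicz (Φ : ℝ → ℝ) (Ω : Set (EuclideanSpace ℝ (Fin N)))
    (u : EuclideanSpace ℝ (Fin N) → ℝ) : Prop :=
  ∃ G : EuclideanSpace ℝ (Fin N) → EuclideanSpace ℝ (Fin N),
    HasWeakGradientOn u G Ω ∧ MemOrlicz Φ Ω G ∧
    ∃ v : ℕ → EuclideanSpace ℝ (Fin N) → ℝ,
      (∀ n, ContDiff ℝ ∞ (v n) ∧ HasCompactSupport (v n)) ∧
      Tendsto (fun n => luxemburgNorm Φ Ω (fun x => gradient (v n) x - G x)) atTop (𝓝 0) ∧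
      ∀ K : Set (EuclideanSpace ℝ (Fin N)), IsCompact K → K ⊆ Ω →
        Tendsto (fun n => ∫⁻ x in K, ‖v n x - u x‖ₑ) atTop (𝓝 0)

/-- The vector field `φ(|ξ|) ξ / |ξ|`, equal to `0` at `ξ = 0`. -/
noncomputable def phiField (Φ : ℝ → ℝ) (ξ : EuclideanSpace ℝ (Fin N)) :
    EuclideanSpace ℝ (Fin N) :=
  (deriv Φ ‖ξ‖ / ‖ξ‖) • ξ

/-- A function `u` of class `C¹` on the open set `Ω` solves `-Δ_Φ u = f` in `Ω` in the sense of
distributions, where `Δ_Φ u = div (φ(|∇u|) ∇u / |∇u|)`. -/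
def SolvesNegPhiLaplace (Φ : ℝ → ℝ) (Ω : Set (EuclideanSpace ℝ (Fin N)))
    (u f : EuclideanSpace ℝ (Fin N) → ℝ) : Prop :=
  LocallyIntegrableOn (fun x => phiField Φ (gradient u x)) Ω ∧ LocallyIntegrableOn f Ω ∧
    ∀ ξ : EuclideanSpace ℝ (Fin N) → ℝ, ContDiff ℝ ∞ ξ → HasCompactSupport ξ → tsupport ξ ⊆ Ω →
      ∫ x, inner ℝ (phiField Φ (gradient u x)) (gradient ξ x) = ∫ x, f x * ξ x

end Spaces

/-- The integrand `ρ ↦ φ⁻¹(ν/(N-l) ρ^{1-l} + k ρ^{1-N})`. -/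
noncomputable def radialIntegrand (N : ℕ) (Φ : ℝ → ℝ) (l ν k ρ : ℝ) : ℝ :=
  phiInv Φ (ν / ((N : ℝ) - l) * ρ ^ (1 - l) + k * ρ ^ (1 - (N : ℝ)))

/-!
The problem is radial. For a radial function with radial derivative `-d` the field
`φ(|∇w|) ∇w / |∇w|` is `-φ(d) x / |x|` with `φ` extended oddly, so choosing
`d = φ⁻¹(ν/(N-l) ρ^{1-l} + k ρ^{1-N})` makes the field equal to the explicit
`-(ν/(N-l) |x|^{-l} + k |x|^{-N}) x`, whatever `Φ` is. This field is smooth off the origin and its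
divergence is `-ν |x|^{-l}`: the term in `k` is divergence free. The equation then follows by
integration by parts against a test function (`integral_inner_radial_gradient`,
`IsElliptic.solvesNegPhiLaplace_radial`).

What depends on `Φ` is integrability at infinity. From `t Φ'(t) ≤ s Φ(t)` with `1 < s < N` the
function `Φ(t) / t ^ s` is nonincreasing, hence `φ⁻¹(y) ≤ C y ^ (1 / (s - 1))` for small `y`, and
`φ⁻¹(K ρ^{1-N})` is integrable at infinity because `(N - 1) / (s - 1) > 1`
(`IsElliptic.integrableOn_phiInv_rpow`). This profile dominates the integrand on `[r, ∞)` for `K`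
large, since `l > N`. The value `∫_r^∞ φ⁻¹(ν/(N-l) ρ^{1-l} + k ρ^{1-N}) dρ` is therefore
continuous and strictly increasing in `k`, and it is unbounded. At `k = 0` it is the threshold
integral if `ν = -μ` and is nonpositive if `ν = μ`; in both cases it is less than `c`, so exactly
one `k > 0` gives the value `c`.

For membership in the Beppo Levi space, multiplying `w` by a cutoff would call for a Hardy type
inequality. Instead the radial derivative is cut off and smoothed in one dimension, and
then integrated from infinity. The primitives are test functions, constant near the origin, and the
modular of the error in the gradient tends to `0` by dominated convergence, with a majorant
`Φ(C φ⁻¹(K |x|^{1-N}))` that is integrable by `Φ(t) ≤ t φ(t)`, polar coordinates and the `Δ₂`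
condition (`IsElliptic.memBeppoLeviOrlicz_radial`, `IsElliptic.lintegral_phiInv_rpow_lt_top`).
-/

/-! ### The derivative of a Young function -/

namespace IsElliptic

variable {N : ℕ} {Φ : ℝ → ℝ}

lemma apply_zero (h : IsElliptic N Φ) : Φ 0 = 0 := (h.young.eq_zero_iff 0 le_rfl).2 rfl

lemma pos (h : IsElliptic N Φ) {t : ℝ} (ht : 0 < t) : 0 < Φ t :=
  (h.young.nonneg t ht.le).lt_of_ne fun h0 => ht.ne' ((h.young.eq_zero_iff t ht.le).1 h0.symm)

lemma hasDerivAt (h : IsElliptic N Φ) {t : ℝ} (ht : 0 < t) : HasDerivAt Φ (deriv Φ t) t :=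
  ((h.contDiffOn.differentiableOn (by norm_num)).differentiableAt
    (Ioi_mem_nhds ht)).hasDerivAt

lemma contDiffOn_deriv (h : IsElliptic N Φ) : ContDiffOn ℝ 1 (deriv Φ) (Ioi 0) :=
  h.contDiffOn.deriv_of_isOpen isOpen_Ioi (by norm_num)

lemma continuousOn_deriv (h : IsElliptic N Φ) : ContinuousOn (deriv Φ) (Ioi 0) :=
  h.contDiffOn_deriv.continuousOn

lemma le_mul_deriv (h : IsElliptic N Φ) {t : ℝ} (ht : 0 < t) : Φ t ≤ t * deriv Φ t := by
  have := h.young.convexOn.slope_le_deriv (self_mem_Ici) ht.le ht (h.hasDerivAt ht).differentiableAt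
  rw [slope_def_field, h.apply_zero, sub_zero, sub_zero, div_le_iff₀ ht] at this
  linarith

lemma deriv_pos (h : IsElliptic N Φ) {t : ℝ} (ht : 0 < t) : 0 < deriv Φ t :=
  pos_of_mul_pos_right ((h.pos ht).trans_le (h.le_mul_deriv ht)) ht.le

lemma mul_deriv_le (h : IsElliptic N Φ) {t : ℝ} (ht : 0 < t) : t * deriv Φ t ≤ Φ (2 * t) := by
  have := h.young.convexOn.deriv_le_slope (x := t) (y := 2 * t) ht.le (by simp; linarith)
    (by linarith) (h.hasDerivAt ht).differentiableAt
  rw [slope_def_field, le_div_iff₀ (by linarith)] at this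
  linarith [h.pos ht]

/-- The lower bound `i_φ > 0` says that `φ' > 0`. -/
lemma strictMonoOn_deriv (h : IsElliptic N Φ) : StrictMonoOn (deriv Φ) (Ioi 0) := by
  refine strictMonoOn_of_deriv_pos (convex_Ioi 0) h.continuousOn_deriv fun t ht => ?_
  rw [interior_Ioi] at ht
  have ht : 0 < t := ht
  have h1 : (0 : EReal) < ((t * deriv (deriv Φ) t / deriv Φ t : ℝ) : EReal) :=
    h.lower_pos.trans_le (iInf_le _ (⟨t, ht⟩ : Ioi (0 : ℝ)))
  have h2 : 0 < t * deriv (deriv Φ) t / deriv Φ t := by exact_mod_cast h1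
  rw [div_pos_iff_of_pos_right (h.deriv_pos ht)] at h2
  exact pos_of_mul_pos_right h2 ht.le

/-- By convexity `φ(t) ≤ 2 Φ(2t) / (2t)`. -/
lemma tendsto_deriv_zero (h : IsElliptic N Φ) : Tendsto (deriv Φ) (𝓝[>] 0) (𝓝 0) := by
  have h1 : Tendsto (fun t : ℝ => 2 * t) (𝓝[>] 0) (𝓝[>] 0) := by
    refine tendsto_nhdsWithin_iff.2 ⟨?_, ?_⟩
    · have : Tendsto (fun t : ℝ => 2 * t) (𝓝 0) (𝓝 (2 * 0)) :=
        (continuous_const.mul continuous_id).tendsto 0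
      rw [mul_zero] at this
      exact this.mono_left nhdsWithin_le_nhds
    · filter_upwards [self_mem_nhdsWithin] with t ht
      simpa using ht
  have h2 := (h.young.tendsto_zero.comp h1).const_mul 2
  rw [mul_zero] at h2
  refine tendsto_of_tendsto_of_tendsto_of_le_of_le' tendsto_const_nhds h2 ?_ ?_
  · filter_upwards [self_mem_nhdsWithin] with t ht using (h.deriv_pos ht).le
  · filter_upwards [self_mem_nhdsWithin] with t ht
    have ht : 0 < t := ht
    have := h.mul_deriv_le ht
    simp only [Function.comp_apply]
    have h3 : 2 * (Φ (2 * t) / (2 * t)) = Φ (2 * t) / t := by field_simp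
    rw [h3, le_div_iff₀ ht]
    linarith

lemma tendsto_deriv_atTop (h : IsElliptic N Φ) : Tendsto (deriv Φ) atTop atTop := by
  refine tendsto_atTop_mono' _ ?_ h.young.tendsto_atTop
  filter_upwards [eventually_gt_atTop 0] with t ht
  rw [div_le_iff₀ ht]
  linarith [h.le_mul_deriv ht]

lemma exists_deriv_eq (h : IsElliptic N Φ) {y : ℝ} (hy : 0 < y) : ∃ t, 0 < t ∧ deriv Φ t = y := by
  obtain ⟨a, ha, ha0⟩ := ((h.tendsto_deriv_zero.eventually (gt_mem_nhds hy)).and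
    self_mem_nhdsWithin).exists
  obtain ⟨b, hb, hb0⟩ := ((h.tendsto_deriv_atTop.eventually (eventually_gt_atTop y)).and
    (eventually_gt_atTop 0)).exists
  obtain ⟨t, ht, hty⟩ := (isPreconnected_Ioi (a := (0 : ℝ))).intermediate_value ha0 hb0
    h.continuousOn_deriv ⟨ha.le, hb.le⟩
  exact ⟨t, ht, hty⟩

end IsElliptic

/-! ### The odd extension of the derivative and its inverse -/

lemma oddPhi_of_pos (Φ : ℝ → ℝ) {t : ℝ} (ht : 0 < t) : oddPhi Φ t = deriv Φ t := by
  simp [oddPhi, Real.sign_of_pos ht, abs_of_pos ht]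

@[simp] lemma oddPhi_zero (Φ : ℝ → ℝ) : oddPhi Φ 0 = 0 := by simp [oddPhi]

lemma oddPhi_neg (Φ : ℝ → ℝ) (t : ℝ) : oddPhi Φ (-t) = -oddPhi Φ t := by
  simp [oddPhi, Real.sign_neg]

namespace IsElliptic

variable {N : ℕ} {Φ : ℝ → ℝ}

lemma strictMono_oddPhi (h : IsElliptic N Φ) : StrictMono (oddPhi Φ) := by
  refine strictMono_of_odd_strictMonoOn_nonneg (oddPhi_neg Φ) fun a ha b _ hab => ?_
  have ha : 0 ≤ a := ha
  rw [oddPhi_of_pos Φ (ha.trans_lt hab)]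
  rcases ha.eq_or_lt with rfl | ha
  · rw [oddPhi_zero]; exact h.deriv_pos hab
  · rw [oddPhi_of_pos Φ ha]
    exact h.strictMonoOn_deriv ha (ha.trans hab) hab

lemma surjective_oddPhi (h : IsElliptic N Φ) : Function.Surjective (oddPhi Φ) := by
  intro y
  rcases lt_trichotomy y 0 with hy | rfl | hy
  · obtain ⟨t, ht, hty⟩ := h.exists_deriv_eq (neg_pos.2 hy)
    exact ⟨-t, by rw [oddPhi_neg, oddPhi_of_pos Φ ht, hty, neg_neg]⟩
  · exact ⟨0, oddPhi_zero Φ⟩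
  · obtain ⟨t, ht, hty⟩ := h.exists_deriv_eq hy
    exact ⟨t, by rw [oddPhi_of_pos Φ ht, hty]⟩

lemma oddPhi_phiInv (h : IsElliptic N Φ) (y : ℝ) : oddPhi Φ (phiInv Φ y) = y :=
  Function.invFun_eq (h.surjective_oddPhi y)

lemma phiInv_oddPhi (h : IsElliptic N Φ) (t : ℝ) : phiInv Φ (oddPhi Φ t) = t :=
  Function.leftInverse_invFun h.strictMono_oddPhi.injective t

lemma strictMono_phiInv (h : IsElliptic N Φ) : StrictMono (phiInv Φ) := by
  intro a b hab
  rw [← h.strictMono_oddPhi.lt_iff_lt, h.oddPhi_phiInv, h.oddPhi_phiInv]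
  exact hab

lemma continuous_phiInv (h : IsElliptic N Φ) : Continuous (phiInv Φ) :=
  h.strictMono_phiInv.monotone.continuous_of_surjective fun t => ⟨_, h.phiInv_oddPhi t⟩

lemma phiInv_zero (h : IsElliptic N Φ) : phiInv Φ 0 = 0 := by
  simpa using h.phiInv_oddPhi 0

lemma phiInv_neg (h : IsElliptic N Φ) (y : ℝ) : phiInv Φ (-y) = -phiInv Φ y := by
  apply h.strictMono_oddPhi.injective
  rw [oddPhi_neg, h.oddPhi_phiInv, h.oddPhi_phiInv]

lemma phiInv_pos (h : IsElliptic N Φ) {y : ℝ} (hy : 0 < y) : 0 < phiInv Φ y := by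
  simpa [h.phiInv_zero] using h.strictMono_phiInv hy

lemma deriv_phiInv (h : IsElliptic N Φ) {y : ℝ} (hy : 0 < y) : deriv Φ (phiInv Φ y) = y := by
  rw [← oddPhi_of_pos Φ (h.phiInv_pos hy), h.oddPhi_phiInv]

lemma abs_phiInv_le (h : IsElliptic N Φ) {y z : ℝ} (hyz : |y| ≤ z) : |phiInv Φ y| ≤ phiInv Φ z := by
  rw [abs_le] at hyz ⊢
  rw [← h.phiInv_neg]
  exact ⟨h.strictMono_phiInv.monotone hyz.1, h.strictMono_phiInv.monotone hyz.2⟩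

end IsElliptic

/-! ### Growth bounds and decay of the fundamental profile -/

namespace IsElliptic

variable {N : ℕ} {Φ : ℝ → ℝ}

/-- Convexity forces `t Φ'(t) / Φ(t) ≥ 1`, so the bound `s_Φ < N` is only possible for `N ≥ 2`. -/
lemma one_lt_dim (h : IsElliptic N Φ) : 1 < N := by
  have h1 : ((1 : ℝ) : EReal) < (N : ℝ) := by
    refine lt_of_le_of_lt ?_ h.upper_lt_dim
    refine le_trans ?_ (le_iSup _ (⟨1, mem_Ioi.2 one_pos⟩ : Ioi (0 : ℝ)))
    norm_cast
    rw [one_le_div (h.pos one_pos)]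
    exact h.le_mul_deriv one_pos
  exact_mod_cast h1

/-- An exponent `s ≥ s_Φ` strictly between `1` and `N`. -/
lemma exists_index (h : IsElliptic N Φ) :
    ∃ s : ℝ, 1 < s ∧ s < N ∧ ∀ t, 0 < t → t * deriv Φ t ≤ s * Φ t := by
  obtain ⟨s, hs, hsN⟩ := EReal.lt_iff_exists_real_btwn.1 h.upper_lt_dim
  have hN : (1 : ℝ) < N := by exact_mod_cast h.one_lt_dim
  -- Enlarge the exponent to exceed `1`, so that `1 / (s - 1)` makes sense.
  refine ⟨max s ((1 + N) / 2), lt_max_of_lt_right (by linarith),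
    max_lt (by exact_mod_cast hsN) (by linarith), fun t ht => ?_⟩
  have h1 : ((t * deriv Φ t / Φ t : ℝ) : EReal) ≤ s :=
    (le_iSup (fun t : Ioi (0 : ℝ) => (((t : ℝ) * deriv Φ t / Φ t : ℝ) : EReal)) ⟨t, ht⟩).trans hs.le
  have h2 : t * deriv Φ t / Φ t ≤ s := by exact_mod_cast h1
  rw [div_le_iff₀ (h.pos ht)] at h2
  exact h2.trans (mul_le_mul_of_nonneg_right (le_max_left _ _) (h.pos ht).le)

/-- If `t Φ'(t) ≤ s Φ(t)`, then `Φ(t) / t ^ s` is nonincreasing. -/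
lemma antitoneOn_div_rpow (h : IsElliptic N Φ) {s : ℝ}
    (hs : ∀ t, 0 < t → t * deriv Φ t ≤ s * Φ t) :
    AntitoneOn (fun t => Φ t * t ^ (-s)) (Ioi 0) := by
  have hd : ∀ t : ℝ, 0 < t → HasDerivAt (fun t => Φ t * t ^ (-s))
      (deriv Φ t * t ^ (-s) + Φ t * (-s * t ^ (-s - 1))) t := fun t ht =>
    (h.hasDerivAt ht).mul (Real.hasDerivAt_rpow_const (Or.inl ht.ne'))
  refine antitoneOn_of_deriv_nonpos (convex_Ioi 0)
    (fun t ht => (hd t ht).continuousAt.continuousWithinAt) ?_ ?_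
  · rw [interior_Ioi]
    exact fun t ht => (hd t ht).differentiableAt.differentiableWithinAt
  · intro t ht
    rw [interior_Ioi] at ht
    have ht : 0 < t := ht
    have h1 : t ^ (-s) = t * t ^ (-s - 1) := by
      rw [mul_comm, ← Real.rpow_add_one ht.ne']; ring_nf
    rw [(hd t ht).deriv, h1]
    nlinarith [hs t ht, Real.rpow_pos_of_pos ht (-s - 1),
      mul_nonneg (sub_nonneg.2 (hs t ht)) (Real.rpow_pos_of_pos ht (-s - 1)).le]

/-- The `Δ₂` condition, for an arbitrary dilation factor. -/
lemma apply_mul_le (h : IsElliptic N Φ) {s : ℝ} (hs : ∀ t, 0 < t → t * deriv Φ t ≤ s * Φ t)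
    {C t : ℝ} (hC : 1 ≤ C) (ht : 0 ≤ t) : Φ (C * t) ≤ C ^ s * Φ t := by
  rcases ht.eq_or_lt with rfl | ht
  · simp [h.apply_zero]
  have hC0 : 0 < C := one_pos.trans_le hC
  have h1 := h.antitoneOn_div_rpow hs (a := t) (b := C * t) ht (mul_pos hC0 ht) (by nlinarith)
  simp only at h1
  rw [Real.mul_rpow hC0.le ht.le, ← mul_assoc] at h1
  have h2 := le_of_mul_le_mul_right h1 (Real.rpow_pos_of_pos ht _)
  rw [Real.rpow_neg hC0.le, ← div_eq_mul_inv, div_le_iff₀ (Real.rpow_pos_of_pos hC0 _)] at h2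
  linarith

lemma continuous_comp_abs (h : IsElliptic N Φ) : Continuous fun t => Φ |t| := by
  have h0 : ContinuousOn Φ (Ici 0) := by
    intro t ht
    rcases (show (0 : ℝ) ≤ t from ht).eq_or_lt with rfl | ht
    · have h1 : Tendsto (fun t => Φ t / t * t) (𝓝[>] 0) (𝓝 (0 * 0)) :=
        h.young.tendsto_zero.mul (tendsto_id.mono_left nhdsWithin_le_nhds)
      rw [← Ioi_insert, continuousWithinAt_insert_self, ContinuousWithinAt, h.apply_zero]
      rw [mul_zero] at h1
      refine h1.congr' ?_
      filter_upwards [self_mem_nhdsWithin] with t ht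
      exact div_mul_cancel₀ _ (ne_of_gt ht)
    · exact (h.hasDerivAt ht).continuousAt.continuousWithinAt
  exact h0.comp_continuous continuous_abs fun t => abs_nonneg t

lemma monotoneOn (h : IsElliptic N Φ) : MonotoneOn Φ (Ici 0) := by
  intro a ha b _ hab
  have ha : 0 ≤ a := ha
  rcases ha.eq_or_lt with rfl | ha
  · rw [h.apply_zero]; exact h.young.nonneg b hab
  · refine monotoneOn_of_deriv_nonneg (convex_Ioi 0)
      (fun t ht => (h.hasDerivAt ht).continuousAt.continuousWithinAt)
      (fun t ht => (h.hasDerivAt (by simpa using ht)).differentiableAt.differentiableWithinAt)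
      (fun t ht => (h.deriv_pos (by simpa using ht)).le) ha (ha.trans_le hab) hab

/-- Near the origin `φ⁻¹` is dominated by the power `y ^ (1 / (s - 1))`. -/
lemma phiInv_le_rpow (h : IsElliptic N Φ) {s : ℝ} (h1s : 1 < s)
    (hs : ∀ t, 0 < t → t * deriv Φ t ≤ s * Φ t) {y : ℝ} (hy : 0 < y) (hy1 : y ≤ deriv Φ 1) :
    phiInv Φ y ≤ (y / Φ 1) ^ (1 / (s - 1)) := by
  have ht := h.phiInv_pos hy
  have ht1 : phiInv Φ y ≤ 1 := by
    rw [← h.phiInv_oddPhi 1, oddPhi_of_pos Φ one_pos]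
    exact h.strictMono_phiInv.monotone hy1
  have hφ := h.deriv_phiInv hy
  set t := phiInv Φ y
  have h2 := h.antitoneOn_div_rpow hs (a := t) (b := 1) ht (mem_Ioi.2 one_pos) ht1
  simp only [Real.one_rpow, mul_one] at h2
  have h3 : t ^ (s - 1) ≤ y / Φ 1 := by
    rw [le_div_iff₀ (h.pos one_pos), ← hφ]
    have h4 : t ^ (s - 1) * t ^ (-s) = t⁻¹ := by
      rw [← Real.rpow_add ht, ← Real.rpow_neg_one]; ring_nf
    have h5 := h.le_mul_deriv ht
    calc t ^ (s - 1) * Φ 1 ≤ t ^ (s - 1) * (Φ t * t ^ (-s)) := by gcongr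
      _ = Φ t * t⁻¹ := by rw [← h4]; ring
      _ ≤ t * deriv Φ t * t⁻¹ := by gcongr
      _ = deriv Φ t := by field_simp
  calc t = (t ^ (s - 1)) ^ (1 / (s - 1)) := by
        rw [← Real.rpow_mul ht.le, mul_one_div_cancel (by linarith), Real.rpow_one]
    _ ≤ _ := Real.rpow_le_rpow (by positivity) h3 (by
        have := sub_pos.2 h1s; positivity)

/-- The decay of the fundamental solution: since `s_Φ < N`, its gradient `φ⁻¹(K ρ^{1-N})` is
integrable at infinity. -/
lemma integrableOn_phiInv_rpow (h : IsElliptic N Φ) {K r : ℝ} (hK : 0 < K) (hr : 0 < r) :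
    IntegrableOn (fun ρ => phiInv Φ (K * ρ ^ (1 - (N : ℝ)))) (Ioi r) := by
  obtain ⟨s, h1s, hsN, hs⟩ := h.exists_index
  have hN : (1 : ℝ) < N := h1s.trans hsN
  have hcont : ContinuousOn (fun ρ => phiInv Φ (K * ρ ^ (1 - (N : ℝ)))) (Ici r) :=
    h.continuous_phiInv.comp_continuousOn <| continuousOn_const.mul <|
      continuousOn_id.rpow_const fun ρ hρ => Or.inl (hr.trans_le hρ).ne'
  have hexp : (1 - (N : ℝ)) * (1 / (s - 1)) < -1 := by
    rw [mul_one_div, div_lt_iff₀ (by linarith)]; linarith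
  refine ((hcont.locallyIntegrableOn measurableSet_Ici).integrableOn_of_isBigO_atTop
    (g := fun ρ => ρ ^ ((1 - (N : ℝ)) * (1 / (s - 1)))) ?_
    ⟨Ioi 1, Ioi_mem_atTop 1, integrableOn_Ioi_rpow_of_lt hexp one_pos⟩).mono_set Ioi_subset_Ici_self
  have hlim : Tendsto (fun ρ : ℝ => K * ρ ^ (1 - (N : ℝ))) atTop (𝓝 0) := by
    have := (tendsto_rpow_neg_atTop (y := (N : ℝ) - 1) (by linarith)).const_mul K
    rw [mul_zero] at this
    simpa using this
  refine Asymptotics.IsBigO.of_bound ((K / Φ 1) ^ (1 / (s - 1))) ?_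
  filter_upwards [eventually_gt_atTop 0, hlim.eventually (ge_mem_nhds (h.deriv_pos one_pos))]
    with ρ hρ hle
  have hp := Real.rpow_pos_of_pos hρ (1 - (N : ℝ))
  have h1 := h.phiInv_le_rpow h1s hs (mul_pos hK hp) hle
  rw [Real.norm_of_nonneg (h.phiInv_pos (mul_pos hK hp)).le, Real.norm_of_nonneg (by positivity)]
  refine h1.trans_eq ?_
  rw [mul_div_right_comm, Real.mul_rpow (div_pos hK (h.pos one_pos)).le hp.le,
    ← Real.rpow_mul hρ.le]

end IsElliptic

/-! ### Radial functions and weak derivatives -/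

section Radial

variable {E : Type*} [NormedAddCommGroup E] [InnerProductSpace ℝ E]

lemma hasFDerivAt_norm_of_ne_zero {x : E} (hx : x ≠ 0) :
    HasFDerivAt (fun y : E => ‖y‖) (‖x‖⁻¹ • innerSL ℝ x) x := by
  have h1 := (hasStrictFDerivAt_norm_sq x).hasFDerivAt.sqrt (pow_ne_zero 2 (norm_ne_zero_iff.2 hx))
  simp only [Real.sqrt_sq (norm_nonneg _)] at h1
  convert h1 using 1
  ext v
  simp
  field_simp

lemma hasGradientAt_comp_norm [CompleteSpace E] {W : ℝ → ℝ} {W' : ℝ} {x : E} (hx : x ≠ 0)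
    (hW : HasDerivAt W W' ‖x‖) : HasGradientAt (fun y => W ‖y‖) ((W' / ‖x‖) • x) x := by
  rw [hasGradientAt_iff_hasFDerivAt]
  refine (hW.comp_hasFDerivAt x (hasFDerivAt_norm_of_ne_zero hx)).congr_fderiv ?_
  ext v
  simp
  ring

end Radial

lemma hasDerivAt_integral_Ioi {g : ℝ → ℝ} {a t : ℝ} (hg : ContinuousOn g (Ioi a))
    (hint : IntegrableOn g (Ioi a)) (hat : a < t) :
    HasDerivAt (fun s => ∫ ρ in Ioi s, g ρ) (-g t) t := by
  obtain ⟨b, hab, hbt⟩ := exists_between hat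
  have hgt : ContinuousAt g t := hg.continuousAt (Ioi_mem_nhds hat)
  have h1 : HasDerivAt (fun s => ∫ ρ in b..s, g ρ) (g t) t := by
    refine intervalIntegral.integral_hasDerivAt_right ?_ ?_ hgt
    · exact (hg.mono fun y hy => by
        rw [uIcc_of_le hbt.le] at hy; exact hab.trans_le hy.1).intervalIntegrable
    · exact hg.stronglyMeasurableAtFilter isOpen_Ioi t hat
  have h2 := h1.const_sub (∫ ρ in Ioi b, g ρ)
  refine h2.congr_of_eventuallyEq ?_
  filter_upwards [Ioi_mem_nhds hbt] with s hs
  have := intervalIntegral.integral_Ioi_sub_Ioi (hint.mono_set (Ioi_subset_Ioi hab.le))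
    (le_of_lt hs)
  linarith

lemma contDiffOn_integral_Ioi {g : ℝ → ℝ} {a : ℝ} (hg : ContinuousOn g (Ioi a))
    (hint : IntegrableOn g (Ioi a)) : ContDiffOn ℝ 1 (fun s => ∫ ρ in Ioi s, g ρ) (Ioi a) := by
  rw [contDiffOn_one_iff_derivWithin (uniqueDiffOn_Ioi a)]
  have hd := fun t (ht : t ∈ Ioi a) => hasDerivAt_integral_Ioi hg hint ht
  refine ⟨fun t ht => (hd t ht).differentiableAt.differentiableWithinAt, hg.neg.congr fun t ht => ?_⟩
  rw [derivWithin_of_isOpen isOpen_Ioi ht, (hd t ht).deriv]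
  rfl

section WeakDerivatives

variable {N : ℕ}

local notation "𝔼" => EuclideanSpace ℝ (Fin N)

lemma continuous_mul_of_tsupport_subset {U : Set 𝔼} (hU : IsOpen U) {a f : 𝔼 → ℝ}
    (ha : ContinuousOn a U) (hf : Continuous f) (hfU : tsupport f ⊆ U) :
    Continuous fun x => a x * f x := by
  refine continuous_of_tsupport fun x hx => ?_
  exact (ha.continuousAt (hU.mem_nhds (hfU (tsupport_mul_subset_right hx)))).mul hf.continuousAt

/-- Integration by parts of a function that is `C¹` on an open set against a test function
supported in that set. -/
lemma integral_mul_fderiv_of_contDiffOn {U : Set 𝔼} (hU : IsOpen U) {a ξ : 𝔼 → ℝ}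
    (ha : ContDiffOn ℝ 1 a U) (hξ : ContDiff ℝ ∞ ξ) (hc : HasCompactSupport ξ)
    (hξU : tsupport ξ ⊆ U) (e : 𝔼) :
    Integrable (fun x => fderiv ℝ a x e * ξ x) ∧ Integrable (fun x => a x * fderiv ℝ ξ x e) ∧
      ∫ x, a x * fderiv ℝ ξ x e = -∫ x, fderiv ℝ a x e * ξ x := by
  have hξ' : Continuous fun x => fderiv ℝ ξ x e :=
    (hξ.continuous_fderiv (by simp)).clm_apply continuous_const
  have hsub : tsupport (fun x => fderiv ℝ ξ x e) ⊆ tsupport ξ := tsupport_fderiv_apply_subset ℝ e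
  have hc' : HasCompactSupport fun x => fderiv ℝ ξ x e := hc.fderiv_apply (𝕜 := ℝ) e
  have ha' : ContinuousOn (fun x => fderiv ℝ a x e) U :=
    (ha.continuousOn_fderiv_of_isOpen hU le_rfl).clm_apply continuousOn_const
  have h1 : Integrable (fun x => fderiv ℝ a x e * ξ x) :=
    (continuous_mul_of_tsupport_subset hU ha' hξ.continuous hξU).integrable_of_hasCompactSupport
      hc.mul_left
  have h2 : Integrable (fun x => a x * fderiv ℝ ξ x e) :=
    (continuous_mul_of_tsupport_subset hU ha.continuousOn hξ'
      (hsub.trans hξU)).integrable_of_hasCompactSupport hc'.mul_left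
  have h3 : Integrable (fun x => a x * ξ x) :=
    (continuous_mul_of_tsupport_subset hU ha.continuousOn hξ.continuous
      hξU).integrable_of_hasCompactSupport hc.mul_left
  refine ⟨h1, h2, integral_mul_fderiv_eq_neg_fderiv_mul_of_integrable h1 h2 h3 (fun x hx => ?_)
    fun x _ => hξ.differentiable (by simp) x⟩
  exact (ha.differentiableOn one_ne_zero).differentiableAt (hU.mem_nhds (hξU hx))

lemma hasWeakGradientOn_of_contDiffOn {U : Set 𝔼} (hU : IsOpen U) {u : 𝔼 → ℝ} {G : 𝔼 → 𝔼}
    (hu : ContDiffOn ℝ 1 u U) (hG : ContinuousOn G U) (hGu : ∀ x ∈ U, HasGradientAt u (G x) x) :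
    HasWeakGradientOn u G U := by
  refine ⟨hu.continuousOn.locallyIntegrableOn hU.measurableSet,
    hG.locallyIntegrableOn hU.measurableSet, fun ξ hξ hc hξU e => ?_⟩
  rw [(integral_mul_fderiv_of_contDiffOn hU hu hξ hc hξU e).2.2]
  congr 1
  refine integral_congr_ae (.of_forall fun x => ?_)
  by_cases hx : x ∈ tsupport ξ
  · simp only [(hGu x (hξU hx)).hasFDerivAt.fderiv, InnerProductSpace.toDual_apply_apply]
  · simp [image_eq_zero_of_notMem_tsupport hx]

lemma contDiffOn_comp_norm {W : ℝ → ℝ} {a : ℝ} (ha : 0 ≤ a) (hW : ContDiffOn ℝ 1 W (Ioi a)) :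
    ContDiffOn ℝ 1 (fun x : 𝔼 => W ‖x‖) {x | a < ‖x‖} := by
  intro x hx
  have hx0 : x ≠ 0 := norm_pos_iff.1 (ha.trans_lt hx)
  exact ((hW.contDiffAt (Ioi_mem_nhds hx)).comp x (contDiffAt_norm ℝ hx0)).contDiffWithinAt

/-- The divergence theorem for a radial field `p(|x|) x`, whose divergence is `ρ p'(ρ) + N p(ρ)`
at `ρ = |x|`, in weak form away from the origin. -/
lemma integral_inner_radial_gradient {p q : ℝ → ℝ} (hp : ContDiffOn ℝ 1 p (Ioi 0))
    (hq : ∀ ρ, 0 < ρ → ρ * deriv p ρ + N * p ρ = q ρ) {ξ : 𝔼 → ℝ} (hξ : ContDiff ℝ ∞ ξ)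
    (hc : HasCompactSupport ξ) (hξU : tsupport ξ ⊆ {0}ᶜ) :
    ∫ x, inner ℝ (p ‖x‖ • x) (gradient ξ x) = -∫ x, q ‖x‖ * ξ x := by
  have hU : IsOpen ({0}ᶜ : Set 𝔼) := isOpen_compl_singleton
  have hpn : ContDiffOn ℝ 1 (fun x : 𝔼 => p ‖x‖) {0}ᶜ :=
    (contDiffOn_comp_norm le_rfl hp).mono fun x hx => norm_pos_iff.2 hx
  have hcoord : ∀ i : Fin N, ContDiffOn ℝ 1 (fun x : 𝔼 => p ‖x‖ * x i) {0}ᶜ := fun i =>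
    hpn.mul (by fun_prop)
  have hib := fun i => integral_mul_fderiv_of_contDiffOn hU (hcoord i) hξ hc hξU
    (EuclideanSpace.single i (1 : ℝ))
  have hleft : ∀ x : 𝔼, inner ℝ (p ‖x‖ • x) (gradient ξ x) =
      ∑ i, (p ‖x‖ * x i) * fderiv ℝ ξ x (EuclideanSpace.single i (1 : ℝ)) := by
    intro x
    have hx : x = ∑ i, x i • EuclideanSpace.single i (1 : ℝ) := by
      simpa using ((EuclideanSpace.basisFun (Fin N) ℝ).sum_repr x).symm
    rw [inner_smul_left, real_inner_comm, gradient, InnerProductSpace.toDual_symm_apply]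
    conv_lhs => rw [congrArg (fderiv ℝ ξ x) hx]
    simp [Finset.mul_sum, mul_assoc]
  have hright : ∀ x : 𝔼, ∑ i, fderiv ℝ (fun x : 𝔼 => p ‖x‖ * x i) x
      (EuclideanSpace.single i (1 : ℝ)) * ξ x = q ‖x‖ * ξ x := by
    intro x
    by_cases hx : x ∈ tsupport ξ
    · have hx0 : x ≠ 0 := hξU hx
      have hn : 0 < ‖x‖ := norm_pos_iff.2 hx0
      have hd : HasDerivAt p (deriv p ‖x‖) ‖x‖ :=
        ((hp.differentiableOn one_ne_zero).differentiableAt (Ioi_mem_nhds hn)).hasDerivAt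
      rw [← Finset.sum_mul, ← hq _ hn]
      congr 1
      have hi : ∀ i : Fin N, fderiv ℝ (fun x : 𝔼 => p ‖x‖ * x i) x
          (EuclideanSpace.single i (1 : ℝ)) = deriv p ‖x‖ / ‖x‖ * (x i) ^ 2 + p ‖x‖ := by
        intro i
        have h1 := (hasGradientAt_comp_norm hx0 hd).hasFDerivAt.mul
          (EuclideanSpace.proj (𝕜 := ℝ) i : 𝔼 →L[ℝ] ℝ).hasFDerivAt
        have h2 : fderiv ℝ (fun x : 𝔼 => p ‖x‖ * x i) x = _ := h1.fderiv
        rw [h2]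
        simp [EuclideanSpace.inner_single_right]
        ring
      rw [Finset.sum_congr rfl fun i _ => hi i, Finset.sum_add_distrib, ← Finset.mul_sum,
        ← EuclideanSpace.real_norm_sq_eq]
      simp
      field_simp
    · simp [image_eq_zero_of_notMem_tsupport hx]
  simp_rw [hleft, ← hright]
  rw [integral_finsetSum _ fun i _ => (hib i).2.1, integral_finsetSum _ fun i _ => (hib i).1,
    ← Finset.sum_neg_distrib]
  exact Finset.sum_congr rfl fun i _ => (hib i).2.2

end WeakDerivatives

/-! ### Approximation of radial functions by test functions -/

/-- A continuous function on `[r, ∞)` dominated by `γ` has smooth approximants that are supported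
in `[r/2, n+1]`, stay within `2γ` of it, and are within `γ / (n+1)` of it on `[r, n]`. -/
lemma exists_smooth_approx_on_Ici {g γ : ℝ → ℝ} {r : ℝ} (hr : 0 < r)
    (hg : ContinuousOn g (Ici r)) (hγ : ContinuousOn γ (Ici r)) (hγ0 : ∀ ρ, r ≤ ρ → 0 < γ ρ)
    (hle : ∀ ρ, r ≤ ρ → |g ρ| ≤ γ ρ) (n : ℕ) :
    ∃ h : ℝ → ℝ, ContDiff ℝ ∞ h ∧ (∀ ρ, ρ ≤ r / 2 → h ρ = 0) ∧ (∀ ρ : ℝ, n + 1 ≤ ρ → h ρ = 0) ∧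
      (∀ ρ, r ≤ ρ → |h ρ - g ρ| ≤ 2 * γ ρ) ∧
      (∀ ρ : ℝ, r ≤ ρ → ρ ≤ n → |h ρ - g ρ| ≤ γ ρ / (n + 1)) := by
  have hn : (0 : ℝ) < n + 1 := by positivity
  -- Extend `g` and `γ` to the line by their values at `r`, to apply global approximation.
  have hext : ∀ f : ℝ → ℝ, ContinuousOn f (Ici r) → Continuous fun ρ => f (max ρ r) := fun f hf =>
    hf.comp_continuous (by fun_prop) fun ρ => mem_Ici.2 (le_max_right _ _)
  obtain ⟨s, hs, hsg, -⟩ := (hext g hg).exists_contDiff_approx ⊤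
    ((hext γ hγ).div_const ((n : ℝ) + 1)) fun ρ => div_pos (hγ0 _ (le_max_right _ _)) hn
  have hs' : ∀ ρ, r ≤ ρ → |s ρ - g ρ| ≤ γ ρ / (n + 1) := fun ρ hρ => by
    have := (hsg ρ).le
    rwa [max_eq_left hρ, Real.dist_eq] at this
  refine ⟨fun ρ => Real.smoothTransition (2 * ρ / r - 1) * Real.smoothTransition (n + 1 - ρ) * s ρ,
    ?_, ?_, ?_, ?_, ?_⟩
  · refine ContDiff.mul (ContDiff.mul ?_ ?_) hs
    · exact Real.smoothTransition.contDiff.comp (by fun_prop)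
    · exact Real.smoothTransition.contDiff.comp (by fun_prop)
  · intro ρ hρ
    dsimp only
    rw [Real.smoothTransition.zero_of_nonpos (x := 2 * ρ / r - 1), zero_mul, zero_mul]
    rw [sub_nonpos, div_le_one hr]; linarith
  · intro ρ hρ
    dsimp only
    rw [Real.smoothTransition.zero_of_nonpos (x := (n : ℝ) + 1 - ρ) (by linarith), mul_zero,
      zero_mul]
  · intro ρ hρ
    dsimp only
    rw [Real.smoothTransition.one_of_one_le (x := 2 * ρ / r - 1)
      (by rw [le_sub_iff_add_le, le_div_iff₀ hr]; linarith), one_mul]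
    have h0 := Real.smoothTransition.nonneg ((n : ℝ) + 1 - ρ)
    have h1 := Real.smoothTransition.le_one ((n : ℝ) + 1 - ρ)
    set χ := Real.smoothTransition ((n : ℝ) + 1 - ρ)
    have h2 : γ ρ / (n + 1) ≤ γ ρ := div_le_self (hγ0 ρ hρ).le (by linarith [n.cast_nonneg (α := ℝ)])
    calc |χ * s ρ - g ρ| = |χ * (s ρ - g ρ) - (1 - χ) * g ρ| := by ring_nf
      _ ≤ |χ * (s ρ - g ρ)| + |(1 - χ) * g ρ| := abs_sub _ _
      _ = χ * |s ρ - g ρ| + (1 - χ) * |g ρ| := by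
          rw [abs_mul, abs_mul, abs_of_nonneg h0, abs_of_nonneg (sub_nonneg.2 h1)]
      _ ≤ 1 * γ ρ + 1 * γ ρ := by
          gcongr
          · exact (hs' ρ hρ).trans h2
          · linarith
          · exact hle ρ hρ
      _ = 2 * γ ρ := by ring
  · intro ρ hρ hρn
    dsimp only
    rw [Real.smoothTransition.one_of_one_le (x := 2 * ρ / r - 1)
      (by rw [le_sub_iff_add_le, le_div_iff₀ hr]; linarith),
      Real.smoothTransition.one_of_one_le (by linarith), one_mul, one_mul]
    exact hs' ρ hρ

section Spaces

variable {N : ℕ}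

local notation "𝔼" => EuclideanSpace ℝ (Fin N)

/-- The radial primitive of a smooth profile supported in a compact subset of `(0, ∞)` is a test
function: it is constant near the origin and vanishes far away. -/
lemma contDiff_integral_Ioi_norm {h : ℝ → ℝ} {a b : ℝ} (ha : 0 < a) (hh : ContDiff ℝ ∞ h)
    (h0 : ∀ ρ, ρ ≤ a → h ρ = 0) (h1 : ∀ ρ, b ≤ ρ → h ρ = 0) :
    Integrable h ∧ ContDiff ℝ ∞ (fun x : 𝔼 => ∫ ρ in Ioi ‖x‖, h ρ) ∧
      HasCompactSupport (fun x : 𝔼 => ∫ ρ in Ioi ‖x‖, h ρ) ∧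
      ∀ x : 𝔼, x ≠ 0 →
        HasGradientAt (fun x : 𝔼 => ∫ ρ in Ioi ‖x‖, h ρ) ((-h ‖x‖ / ‖x‖) • x) x := by
  have hcs : HasCompactSupport h := by
    refine HasCompactSupport.of_support_subset_isCompact (isCompact_Icc (a := a) (b := b)) ?_
    intro ρ hρ
    refine ⟨le_of_not_ge fun hle => hρ (h0 ρ hle), le_of_not_ge fun hle => hρ (h1 ρ hle)⟩
  have hint : Integrable h := hh.continuous.integrable_of_hasCompactSupport hcs
  have hd : ∀ t, HasDerivAt (fun s => ∫ ρ in Ioi s, h ρ) (-h t) t := fun t =>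
    hasDerivAt_integral_Ioi (a := t - 1) hh.continuous.continuousOn hint.integrableOn (by linarith)
  have hsmooth : ContDiff ℝ ∞ (fun s => ∫ ρ in Ioi s, h ρ) := by
    refine contDiff_infty_iff_deriv.2 ⟨fun t => (hd t).differentiableAt, ?_⟩
    rw [funext fun t => (hd t).deriv]
    exact hh.neg
  refine ⟨hint, ?_, ?_, fun x hx => hasGradientAt_comp_norm hx (hd _)⟩
  · rw [contDiff_iff_contDiffAt]
    intro x
    by_cases hx : x = 0
    · subst hx
      refine (contDiffAt_const (c := ∫ ρ in Ioi a, h ρ)).congr_of_eventuallyEq ?_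
      filter_upwards [Metric.ball_mem_nhds (0 : 𝔼) ha] with y hy
      have hy : ‖y‖ < a := by simpa using hy
      rw [← sub_eq_zero, intervalIntegral.integral_Ioi_sub_Ioi hint.integrableOn hy.le]
      refine intervalIntegral.integral_zero_ae (.of_forall fun ρ hρ => h0 ρ ?_)
      rw [uIoc_of_le hy.le] at hρ
      exact hρ.2
    · exact hsmooth.contDiffAt.comp x (contDiffAt_norm ℝ hx)
  · refine HasCompactSupport.intro (isCompact_closedBall (0 : 𝔼) b) fun x hx => ?_
    have hx : b < ‖x‖ := by simpa using hx
    exact setIntegral_eq_zero_of_forall_eq_zero fun ρ hρ => h1 ρ (hx.le.trans (le_of_lt hρ))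

/-- A radial function whose radial derivative is dominated by an integrable profile `γ`, with
`γ(|x|)` in the Orlicz class, belongs to the Beppo Levi space of the exterior of the ball. The
approximants are radial primitives of smooth compactly supported approximants of the derivative. -/
lemma IsElliptic.memBeppoLeviOrlicz_radial {Φ : ℝ → ℝ} (hΦ : IsElliptic N Φ) {g γ : ℝ → ℝ} {r : ℝ}
    (hr : 0 < r) (hg : ContinuousOn g (Ici r)) (hγ : ContinuousOn γ (Ici r))
    (hγ0 : ∀ ρ, r ≤ ρ → 0 < γ ρ) (hle : ∀ ρ, r ≤ ρ → |g ρ| ≤ γ ρ) (hint : IntegrableOn γ (Ioi r))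
    (hfin : ∫⁻ x : 𝔼 in (Metric.closedBall 0 r)ᶜ, ENNReal.ofReal (Φ (γ ‖x‖)) < ⊤) :
    MemBeppoLeviOrlicz Φ (Metric.closedBall (0 : 𝔼) r)ᶜ (fun x => ∫ ρ in Ioi ‖x‖, g ρ) := by
  have hΩ : ∀ x : 𝔼, x ∈ (Metric.closedBall (0 : 𝔼) r)ᶜ ↔ r < ‖x‖ := fun x => by simp
  have hΩo : IsOpen (Metric.closedBall (0 : 𝔼) r)ᶜ := Metric.isClosed_closedBall.isOpen_compl
  set Ω := (Metric.closedBall (0 : 𝔼) r)ᶜ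
  have hΩm : MeasurableSet Ω := hΩo.measurableSet
  have hnorm : ∀ x ∈ Ω, 0 < ‖x‖ := fun x hx => hr.trans ((hΩ x).1 hx)
  have hrad : ∀ f : ℝ → ℝ, ContinuousOn f (Ici r) → ContinuousOn (fun x : 𝔼 => f ‖x‖) Ω :=
    fun f hf => hf.comp continuous_norm.continuousOn fun x hx => ((hΩ x).1 hx).le
  have hgint : IntegrableOn g (Ioi r) :=
    hint.mono' ((hg.mono Ioi_subset_Ici_self).aestronglyMeasurable measurableSet_Ioi)
      ((ae_restrict_mem measurableSet_Ioi).mono fun ρ hρ => hle ρ (le_of_lt hρ))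
  have hg' := hg.mono Ioi_subset_Ici_self
  set G : 𝔼 → 𝔼 := fun x => (-g ‖x‖ / ‖x‖) • x
  have hGc : ContinuousOn G Ω :=
    ((hrad g hg).neg.div continuous_norm.continuousOn fun x hx => (hnorm x hx).ne').smul
      continuousOn_id
  have hnG : ∀ (d : ℝ) (x : 𝔼), x ∈ Ω → ‖(d / ‖x‖) • x‖ = |d| := fun d x hx => by
    rw [norm_smul, norm_div, norm_norm, Real.norm_eq_abs, div_mul_cancel₀ _ (hnorm x hx).ne']
  refine ⟨G, ?_, ⟨hGc.aestronglyMeasurable hΩm, ?_⟩, ?_⟩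
  · refine hasWeakGradientOn_of_contDiffOn hΩo ?_ hGc fun x hx => ?_
    · exact (contDiffOn_comp_norm hr.le (contDiffOn_integral_Ioi hg' hgint)).mono
        fun x hx => (hΩ x).1 hx
    · exact hasGradientAt_comp_norm (norm_pos_iff.1 (hnorm x hx))
        (hasDerivAt_integral_Ioi hg' hgint ((hΩ x).1 hx))
  · refine lt_of_le_of_lt (setLIntegral_mono_ae' hΩm (.of_forall fun x hx => ?_)) hfin
    have hx' := ((hΩ x).1 hx).le
    rw [hnG _ x hx, abs_neg]
    exact ENNReal.ofReal_le_ofReal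
      (hΦ.monotoneOn (mem_Ici.2 (abs_nonneg _)) (hγ0 _ hx').le (hle _ hx'))
  choose h hh h0 h1 h2γ hn using exists_smooth_approx_on_Ici hr hg hγ hγ0 hle
  have htest := fun n => contDiff_integral_Ioi_norm (N := N) (half_pos hr) (hh n) (h0 n) (h1 n)
  have hlim : ∀ ρ, r ≤ ρ → Tendsto (fun n => h n ρ - g ρ) atTop (𝓝 0) := fun ρ hρ => by
    have h3 : Tendsto (fun n : ℕ => γ ρ / ((n : ℝ) + 1)) atTop (𝓝 0) :=
      tendsto_const_div_atTop_nhds_zero_nat (γ ρ) |>.comp (tendsto_add_atTop_nat 1) |>.congr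
        fun n => by simp
    refine squeeze_zero_norm' ?_ h3
    filter_upwards [tendsto_natCast_atTop_atTop.eventually (eventually_ge_atTop ρ)] with n hρn
    exact hn n ρ hρ hρn
  refine ⟨fun n x => ∫ ρ in Ioi ‖x‖, h n ρ, fun n => ⟨(htest n).2.1, (htest n).2.2.1⟩, ?_, ?_⟩
  -- Norm convergence: for each `τ > 0` the modular of the error divided by `τ` tends to `0`.
  · obtain ⟨s, -, -, hs⟩ := hΦ.exists_index
    rw [ENNReal.tendsto_nhds_zero]
    intro ε hε
    obtain ⟨τ, hτ0, hτε⟩ := ENNReal.lt_iff_exists_nnreal_btwn.1 hε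
    have hτ : (0 : ℝ) < τ := by exact_mod_cast hτ0
    have hmod : Tendsto (fun n => ∫⁻ x in Ω, ENNReal.ofReal (Φ |(h n ‖x‖ - g ‖x‖) / τ|)) atTop
        (𝓝 (∫⁻ x in Ω, 0)) := by
      set C : ℝ := max 1 (2 / τ)
      refine tendsto_lintegral_of_dominated_convergence'
        (fun x => ENNReal.ofReal (C ^ s) * ENNReal.ofReal (Φ (γ ‖x‖))) (fun n => ?_) (fun n => ?_)
        ?_ ?_
      · refine (ContinuousOn.aestronglyMeasurable ?_ hΩm).aemeasurable
        refine ENNReal.continuous_ofReal.comp_continuousOn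
          (hΦ.continuous_comp_abs.comp_continuousOn (ContinuousOn.div_const ?_ _))
        exact hrad (fun ρ => h n ρ - g ρ) ((hh n).continuous.continuousOn.sub hg)
      · filter_upwards [ae_restrict_mem hΩm] with x hx
        have hx' := ((hΩ x).1 hx).le
        have hC : 1 ≤ C := le_max_left _ _
        rw [← ENNReal.ofReal_mul (by positivity)]
        refine ENNReal.ofReal_le_ofReal (le_trans ?_ (hΦ.apply_mul_le hs hC (hγ0 _ hx').le))
        refine hΦ.monotoneOn (mem_Ici.2 (abs_nonneg _)) (mul_nonneg (by positivity) (hγ0 _ hx').le) ?_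
        rw [abs_div, abs_of_pos hτ]
        calc |h n ‖x‖ - g ‖x‖| / τ ≤ 2 * γ ‖x‖ / τ := by gcongr; exact h2γ n _ hx'
          _ = 2 / τ * γ ‖x‖ := by ring
          _ ≤ C * γ ‖x‖ := mul_le_mul_of_nonneg_right (le_max_right _ _) (hγ0 _ hx').le
      · rw [lintegral_const_mul' _ _ ENNReal.ofReal_ne_top]
        exact (ENNReal.mul_lt_top ENNReal.ofReal_lt_top hfin).ne
      · filter_upwards [ae_restrict_mem hΩm] with x hx
        have h3 := ((hlim ‖x‖ ((hΩ x).1 hx).le).div_const (τ : ℝ))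
        have h4 := (ENNReal.continuous_ofReal.comp hΦ.continuous_comp_abs).continuousAt.tendsto.comp
          h3
        simpa [Function.comp_def, hΦ.apply_zero] using h4
    rw [lintegral_zero] at hmod
    filter_upwards [hmod.eventually (ge_mem_nhds one_pos)] with n hn1
    refine le_trans ?_ hτε.le
    rw [← ENNReal.ofReal_coe_nnreal]
    refine iInf_le_of_le (τ : ℝ) (iInf_le_of_le hτ (iInf_le_of_le ?_ le_rfl))
    refine (setLIntegral_congr_fun hΩm fun x hx => ?_).trans_le hn1
    have h3 := ((htest n).2.2.2 x (norm_pos_iff.1 (hnorm x hx))).gradient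
    simp only [h3, G]
    rw [← sub_smul, ← sub_div, hnG _ x hx, abs_div, abs_of_pos hτ, ← abs_neg]
    congr 4
    ring
  -- Convergence on compact sets: the error is at most `∫_r^∞ |h n - g|`, uniformly in `x`.
  · intro K hK hKΩ
    have hη : Tendsto (fun n => ∫ ρ in Ioi r, ‖h n ρ - g ρ‖) atTop (𝓝 (∫ ρ in Ioi r, (0 : ℝ))) := by
      refine tendsto_integral_of_dominated_convergence (fun ρ => 2 * γ ρ) (fun n => ?_)
        (hint.const_mul 2) (fun n => ?_) ?_
      · exact (((hh n).continuous.continuousOn.sub hg').aestronglyMeasurable measurableSet_Ioi).norm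
      · filter_upwards [ae_restrict_mem measurableSet_Ioi] with ρ hρ
        rw [norm_norm]
        exact h2γ n ρ (le_of_lt hρ)
      · filter_upwards [ae_restrict_mem measurableSet_Ioi] with ρ hρ
        simpa using (hlim ρ (le_of_lt hρ)).norm
    rw [integral_zero] at hη
    have hη' : Tendsto (fun n => ENNReal.ofReal (∫ ρ in Ioi r, ‖h n ρ - g ρ‖) * volume K) atTop
        (𝓝 0) := by
      have := ENNReal.Tendsto.mul_const (ENNReal.tendsto_ofReal hη)
        (Or.inr hK.measure_lt_top.ne : ENNReal.ofReal 0 ≠ 0 ∨ volume K ≠ ⊤)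
      simpa using this
    refine tendsto_of_tendsto_of_tendsto_of_le_of_le tendsto_const_nhds hη' (fun _ => zero_le)
      fun n => ?_
    refine (setLIntegral_mono_ae' hK.measurableSet (g := fun _ =>
      ENNReal.ofReal (∫ ρ in Ioi r, ‖h n ρ - g ρ‖)) (.of_forall fun x hx => ?_)).trans_eq
      (setLIntegral_const _ _)
    have hx' := (hΩ x).1 (hKΩ hx)
    have hhr : IntegrableOn (h n) (Ioi r) := (htest n).1.integrableOn
    have hsub : Ioi ‖x‖ ⊆ Ioi r := Ioi_subset_Ioi hx'.le
    rw [← integral_sub (hhr.mono_set hsub) (hgint.mono_set hsub), ← ofReal_norm]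
    refine ENNReal.ofReal_le_ofReal ((norm_integral_le_integral_norm _).trans ?_)
    exact setIntegral_mono_set (hhr.sub hgint).norm (.of_forall fun ρ => norm_nonneg _)
      hsub.eventuallyLE

/-- In polar coordinates the modular of `φ⁻¹(K |x|^{1-N})` is controlled by the integral of
`φ⁻¹(K ρ^{1-N})`, because `Φ(t) ≤ t φ(t)`. -/
lemma IsElliptic.lintegral_phiInv_rpow_lt_top {Φ : ℝ → ℝ} (hΦ : IsElliptic N Φ) {K r : ℝ}
    (hK : 0 < K) (hr : 0 < r) :
    ∫⁻ x : 𝔼 in (Metric.closedBall 0 r)ᶜ,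
      ENNReal.ofReal (Φ (phiInv Φ (K * ‖x‖ ^ (1 - (N : ℝ))))) < ⊤ := by
  have hN := hΦ.one_lt_dim
  have : Nonempty (Fin N) := ⟨⟨0, by omega⟩⟩
  set f : ℝ → ℝ := (Ioi r).indicator
    fun ρ => phiInv Φ (K * ρ ^ (1 - (N : ℝ))) * (K * ρ ^ (1 - (N : ℝ))) with hf
  have hfi : Integrable (fun x : 𝔼 => f ‖x‖) := by
    rw [integrable_fun_norm_addHaar]
    have h1 : (fun ρ : ℝ => ρ ^ (Module.finrank ℝ 𝔼 - 1) • f ρ) =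
        (Ioi r).indicator fun ρ => K * phiInv Φ (K * ρ ^ (1 - (N : ℝ))) := by
      ext ρ
      by_cases hρ : ρ ∈ Ioi r
      · have hρ0 : 0 < ρ := hr.trans hρ
        have h2 : ρ ^ (N - 1) * ρ ^ (1 - (N : ℝ)) = 1 := by
          rw [← Real.rpow_natCast, ← Real.rpow_add hρ0, Nat.cast_sub hN.le]
          simp
        rw [hf, indicator_of_mem hρ, indicator_of_mem hρ, finrank_euclideanSpace_fin, smul_eq_mul]
        linear_combination K * phiInv Φ (K * ρ ^ (1 - (N : ℝ))) * h2
      · simp [hf, indicator_of_notMem hρ]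
    rw [h1]
    exact ((integrable_indicator_iff measurableSet_Ioi).2
      ((hΦ.integrableOn_phiInv_rpow hK hr).const_mul K)).integrableOn
  refine lt_of_le_of_lt ?_ hfi.lintegral_lt_top
  refine le_trans (setLIntegral_mono_ae' Metric.isClosed_closedBall.measurableSet.compl
    (g := fun x => ENNReal.ofReal (f ‖x‖)) (.of_forall fun x hx => ?_)) (setLIntegral_le_lintegral _ _)
  have hx : r < ‖x‖ := by simpa using hx
  have hy : 0 < K * ‖x‖ ^ (1 - (N : ℝ)) := mul_pos hK (Real.rpow_pos_of_pos (hr.trans hx) _)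
  rw [hf, indicator_of_mem (show ‖x‖ ∈ Ioi r from hx)]
  refine ENNReal.ofReal_le_ofReal ((hΦ.le_mul_deriv (hΦ.phiInv_pos hy)).trans_eq ?_)
  rw [hΦ.deriv_phiInv hy]

end Spaces

/-! ### The boundary value as a function of `k` -/

lemma continuousOn_flux (N : ℕ) (l A k : ℝ) :
    ContinuousOn (fun ρ => A * ρ ^ (1 - l) + k * ρ ^ (1 - (N : ℝ))) (Ioi 0) := by
  have h : ∀ a : ℝ, ContinuousOn (fun ρ : ℝ => ρ ^ a) (Ioi 0) := fun a =>
    continuousOn_id.rpow_const fun ρ hρ => Or.inl (ne_of_gt hρ)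
  exact (continuousOn_const.mul (h _)).add (continuousOn_const.mul (h _))

lemma abs_mul_rpow_le {N : ℕ} {l : ℝ} (hl : (N : ℝ) < l) {r ρ : ℝ} (hr : 0 < r)
    (hρ : r ≤ ρ) (A : ℝ) :
    |A * ρ ^ (1 - l)| ≤ |A| * r ^ ((N : ℝ) - l) * ρ ^ (1 - (N : ℝ)) := by
  have hρ0 : 0 < ρ := hr.trans_le hρ
  have h1 : ρ ^ (1 - l) = ρ ^ ((N : ℝ) - l) * ρ ^ (1 - (N : ℝ)) := by
    rw [← Real.rpow_add hρ0]; ring_nf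
  have h0 : 0 < ρ ^ ((N : ℝ) - l) * ρ ^ (1 - (N : ℝ)) := by positivity
  rw [abs_mul, h1, abs_of_pos h0, mul_assoc]
  have h2 : ρ ^ ((N : ℝ) - l) ≤ r ^ ((N : ℝ) - l) :=
    Real.rpow_le_rpow_of_nonpos hr hρ (by linarith)
  gcongr

namespace IsElliptic

variable {N : ℕ} {Φ : ℝ → ℝ} {l : ℝ}

/-- For `ρ ≥ r` and `l > N` the power `ρ^{1-l}` is absorbed by `ρ^{1-N}`. -/
lemma abs_radialIntegrand_le (h : IsElliptic N Φ) (hl : (N : ℝ) < l) {r ρ k K : ℝ} (hr : 0 < r)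
    (hρ : r ≤ ρ) (hk : |k| ≤ K) (ν : ℝ) :
    |radialIntegrand N Φ l ν k ρ| ≤
      phiInv Φ ((|ν / (N - l)| * r ^ ((N : ℝ) - l) + K) * ρ ^ (1 - (N : ℝ))) := by
  have hp := Real.rpow_pos_of_pos (hr.trans_le hρ) (1 - (N : ℝ))
  refine h.abs_phiInv_le ((abs_add_le _ _).trans ?_)
  rw [add_mul, abs_mul k, abs_of_pos hp]
  exact add_le_add (abs_mul_rpow_le hl hr hρ _) (mul_le_mul_of_nonneg_right hk hp.le)

lemma continuousOn_radialIntegrand (h : IsElliptic N Φ) (l ν k : ℝ) :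
    ContinuousOn (radialIntegrand N Φ l ν k) (Ioi 0) :=
  h.continuous_phiInv.comp_continuousOn (continuousOn_flux N l _ k)

lemma integrableOn_radialIntegrand (h : IsElliptic N Φ) (hl : (N : ℝ) < l) {r : ℝ} (hr : 0 < r)
    (ν k : ℝ) : IntegrableOn (radialIntegrand N Φ l ν k) (Ioi r) := by
  have hk : |k| ≤ |k| + 1 := by linarith
  have hK : 0 < |ν / (N - l)| * r ^ ((N : ℝ) - l) + (|k| + 1) := by positivity
  refine (h.integrableOn_phiInv_rpow hK hr).mono' (((h.continuousOn_radialIntegrand l ν k).mono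
    (Ioi_subset_Ioi hr.le)).aestronglyMeasurable measurableSet_Ioi) ?_
  filter_upwards [ae_restrict_mem measurableSet_Ioi] with ρ hρ
  exact h.abs_radialIntegrand_le hl hr (le_of_lt hρ) hk ν

lemma radialIntegrand_strictMono (h : IsElliptic N Φ) (ν : ℝ) {ρ : ℝ} (hρ : 0 < ρ) :
    StrictMono fun k => radialIntegrand N Φ l ν k ρ := fun a b hab =>
  h.strictMono_phiInv (by gcongr)

/-- The boundary value `∫_r^∞ φ⁻¹(ν/(N-l) ρ^{1-l} + k ρ^{1-N}) dρ` is strictly increasing in `k`. -/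
lemma strictMono_boundaryValue (h : IsElliptic N Φ) (hl : (N : ℝ) < l) {r : ℝ} (hr : 0 < r)
    (ν : ℝ) : StrictMono fun k => ∫ ρ in Ioi r, radialIntegrand N Φ l ν k ρ := by
  intro a b hab
  have hlt : ∀ ρ ∈ Ioi r, radialIntegrand N Φ l ν a ρ < radialIntegrand N Φ l ν b ρ := fun ρ hρ =>
    h.radialIntegrand_strictMono ν (hr.trans hρ) hab
  have hi := h.integrableOn_radialIntegrand hl hr ν
  rw [← sub_pos, ← integral_sub (hi b) (hi a), setIntegral_pos_iff_support_of_nonneg_ae]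
  · refine lt_of_lt_of_le ?_ (measure_mono (s := Ioi r) fun ρ hρ =>
      ⟨(sub_pos.2 (hlt ρ hρ)).ne', hρ⟩)
    simp
  · filter_upwards [ae_restrict_mem measurableSet_Ioi] with ρ hρ
    exact (sub_pos.2 (hlt ρ hρ)).le
  · exact (hi b).sub (hi a)

lemma continuous_boundaryValue (h : IsElliptic N Φ) (hl : (N : ℝ) < l) {r : ℝ} (hr : 0 < r)
    (ν : ℝ) : Continuous fun k => ∫ ρ in Ioi r, radialIntegrand N Φ l ν k ρ := by
  rw [continuous_iff_continuousAt]
  intro k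
  have hK : 0 < |ν / (N - l)| * r ^ ((N : ℝ) - l) + (|k| + 1) := by positivity
  refine continuousAt_of_dominated ?_ ?_ (h.integrableOn_phiInv_rpow hK hr) ?_
  · exact .of_forall fun k => (h.integrableOn_radialIntegrand hl hr ν k).aestronglyMeasurable
  · filter_upwards [continuous_abs.continuousAt.eventually
      (ge_mem_nhds (show |k| < |k| + 1 by linarith))] with k' hk'
    filter_upwards [ae_restrict_mem measurableSet_Ioi] with ρ hρ
    exact h.abs_radialIntegrand_le hl hr (le_of_lt hρ) hk' ν
  · refine .of_forall fun ρ => (h.continuous_phiInv.comp ?_).continuousAt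
    fun_prop

/-- The boundary value exceeds any given level for large `k`: on `(r, 2r)` the argument of `φ⁻¹`
is at least a prescribed constant. -/
lemma exists_lt_boundaryValue (h : IsElliptic N Φ) (hl : (N : ℝ) < l) {r c : ℝ} (hr : 0 < r)
    (hc : 0 < c) (ν : ℝ) : ∃ k, 0 < k ∧ c < ∫ ρ in Ioi r, radialIntegrand N Φ l ν k ρ := by
  have hN : (1 : ℝ) < N := by exact_mod_cast h.one_lt_dim
  set T := c / r + 1 with hT
  have hT0 : 0 < T := by positivity
  set Y := deriv Φ T
  have hY : 0 < Y := h.deriv_pos hT0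
  set B := |ν / (N - l)| * r ^ ((N : ℝ) - l)
  have hB : 0 ≤ B := by positivity
  set D := (2 * r) ^ (1 - (N : ℝ))
  have hD : 0 < D := by positivity
  have hflux : ∀ ρ, r < ρ → Y / D * ρ ^ (1 - (N : ℝ)) ≤
      ν / (N - l) * ρ ^ (1 - l) + (B + Y / D) * ρ ^ (1 - (N : ℝ)) := fun ρ hρ => by
    have := (abs_le.1 (abs_mul_rpow_le hl hr hρ.le (ν / (N - l)))).1
    rw [add_mul]
    linarith
  have hi := h.integrableOn_radialIntegrand hl hr ν (B + Y / D)
  refine ⟨B + Y / D, by positivity, ?_⟩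
  have hnonneg : ∀ ρ, r < ρ → 0 ≤ radialIntegrand N Φ l ν (B + Y / D) ρ := fun ρ hρ => by
    have hρ0 : 0 < ρ := hr.trans hρ
    rw [← h.phiInv_zero]
    exact h.strictMono_phiInv.monotone ((by positivity : (0 : ℝ) ≤ _).trans (hflux ρ hρ))
  calc c < ∫ ρ in Ioc r (2 * r), T := by
        rw [setIntegral_const, Real.volume_real_Ioc_of_le (by linarith), smul_eq_mul, hT]
        field_simp
        linarith
    _ ≤ ∫ ρ in Ioc r (2 * r), radialIntegrand N Φ l ν (B + Y / D) ρ := by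
        refine setIntegral_mono_on (by simp) (hi.mono_set Ioc_subset_Ioi_self) measurableSet_Ioc
          fun ρ hρ => ?_
        have hρ0 : 0 < ρ := hr.trans hρ.1
        rw [← h.phiInv_oddPhi T, oddPhi_of_pos Φ hT0]
        refine h.strictMono_phiInv.monotone (le_trans ?_ (hflux ρ hρ.1))
        rw [div_mul_eq_mul_div, le_div_iff₀ hD]
        gcongr
        exact Real.rpow_le_rpow_of_nonpos hρ0 hρ.2 (by linarith)
    _ ≤ _ := by
        refine setIntegral_mono_set hi ?_ Ioc_subset_Ioi_self.eventuallyLE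
        filter_upwards [ae_restrict_mem measurableSet_Ioi] with ρ hρ using hnonneg ρ hρ

end IsElliptic

/-! ### The radial solution -/

section Solution

variable {N : ℕ}

local notation "𝔼" => EuclideanSpace ℝ (Fin N)

/-- The field of a radial function with radial derivative `-d`. -/
lemma phiField_radial (Φ : ℝ → ℝ) {x : 𝔼} (hx : x ≠ 0) (d : ℝ) :
    phiField Φ ((-d / ‖x‖) • x) = (-oddPhi Φ d / ‖x‖) • x := by
  have hn : 0 < ‖x‖ := norm_pos_iff.2 hx
  rw [phiField, smul_smul, norm_smul, norm_div, norm_norm, Real.norm_eq_abs,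
    div_mul_cancel₀ _ hn.ne', abs_neg, oddPhi]
  congr 1
  rcases lt_trichotomy d 0 with hd | rfl | hd
  · rw [Real.sign_of_neg hd, abs_of_neg hd]
    field_simp [hd.ne]
  · simp
  · rw [Real.sign_of_pos hd, abs_of_pos hd]
    field_simp [hd.ne']

/-- The equation only involves the gradient: `φ` undoes `φ⁻¹` and leaves an explicit field. -/
lemma IsElliptic.solvesNegPhiLaplace_radial {Φ : ℝ → ℝ} (hΦ : IsElliptic N Φ) {l ν k : ℝ}
    (hl : (N : ℝ) < l) {u : 𝔼 → ℝ}
    (hu : ∀ x : 𝔼, x ≠ 0 → HasGradientAt u ((-radialIntegrand N Φ l ν k ‖x‖ / ‖x‖) • x) x) :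
    SolvesNegPhiLaplace Φ {0}ᶜ u (fun x => ν * ‖x‖ ^ (-l)) := by
  -- The field is `p(|x|) x`, since `φ` and `φ⁻¹` cancel.
  set p : ℝ → ℝ := fun ρ => -(ν / (N - l) * ρ ^ (-l) + k * ρ ^ (-(N : ℝ))) with hp
  have hpow : ∀ (a ρ : ℝ), 0 < ρ → ρ ^ (1 - a) / ρ = ρ ^ (-a) := fun a ρ hρ => by
    rw [← Real.rpow_sub_one hρ.ne']; ring_nf
  have hfield : ∀ x : 𝔼, x ≠ 0 → phiField Φ (gradient u x) = p ‖x‖ • x := fun x hx => by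
    have hn : 0 < ‖x‖ := norm_pos_iff.2 hx
    rw [(hu x hx).gradient, phiField_radial Φ hx, radialIntegrand, hΦ.oddPhi_phiInv, neg_div,
      add_div, mul_div_assoc, mul_div_assoc, hpow _ _ hn, hpow _ _ hn]
  have hrpow : ∀ a : ℝ, ContDiffOn ℝ 1 (fun ρ : ℝ => ρ ^ a) (Ioi 0) := fun a ρ hρ =>
    (Real.contDiffAt_rpow_const_of_ne (ne_of_gt hρ)).contDiffWithinAt
  have hpc : ContDiffOn ℝ 1 p (Ioi 0) :=
    ((contDiffOn_const.mul (hrpow _)).add (contDiffOn_const.mul (hrpow _))).neg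
  have hrad : ∀ f : ℝ → ℝ, ContinuousOn f (Ioi 0) → ContinuousOn (fun x : 𝔼 => f ‖x‖) {0}ᶜ :=
    fun f hf => hf.comp continuous_norm.continuousOn fun x hx => norm_pos_iff.2 hx
  have hUm : MeasurableSet ({0}ᶜ : Set 𝔼) := (measurableSet_singleton 0).compl
  refine ⟨?_, ?_, fun ξ hξ hc hξU => ?_⟩
  · refine ContinuousOn.locallyIntegrableOn (ContinuousOn.congr ?_ hfield) hUm
    exact (hrad p hpc.continuousOn).smul continuousOn_id
  · exact (continuousOn_const.mul (hrad _ (hrpow _).continuousOn)).locallyIntegrableOn hUm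
  · have hq : ∀ ρ, 0 < ρ → ρ * deriv p ρ + N * p ρ = -(ν * ρ ^ (-l)) := fun ρ hρ => by
      have hd : HasDerivAt p (-(ν / (N - l) * (-l * ρ ^ (-l - 1)) +
          k * (-(N : ℝ) * ρ ^ (-(N : ℝ) - 1)))) ρ :=
        (((Real.hasDerivAt_rpow_const (Or.inl hρ.ne')).const_mul _).add
          ((Real.hasDerivAt_rpow_const (Or.inl hρ.ne')).const_mul _)).neg
      have hne : (N : ℝ) - l ≠ 0 := by linarith
      rw [hd.deriv, Real.rpow_sub_one hρ.ne', Real.rpow_sub_one hρ.ne', hp]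
      field_simp
      ring
    have hleft : ∀ x : 𝔼, inner ℝ (phiField Φ (gradient u x)) (gradient ξ x) =
        inner ℝ (p ‖x‖ • x) (gradient ξ x) := fun x => by
      -- At the origin the gradient of `u` is unknown, but that of the test function vanishes.
      by_cases hx : x = 0
      · have h0 : fderiv ℝ ξ x = 0 :=
          image_eq_zero_of_notMem_tsupport fun hmem => hξU (tsupport_fderiv_subset ℝ hmem) hx
        simp [gradient, h0]
      · rw [hfield x hx]
    simp_rw [hleft]
    rw [integral_inner_radial_gradient hpc hq hξ hc hξU, ← integral_neg]
    simp

end Solution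

theorem lemma3p2 (N : ℕ) (Φ : ℝ → ℝ) (hΦ : IsElliptic N Φ)
    (c μ r l : ℝ) (hc : 0 < c) (hμ : 0 < μ) (hr : 0 < r) (hl : (N : ℝ) < l)
    (hthr : ∫ τ in Ioi r, phiInv Φ (μ / (l - (N : ℝ)) * τ ^ (1 - l)) < c) :
    ∀ ν : ℝ, (ν = μ ∨ ν = -μ) →
      ∃ w : EuclideanSpace ℝ (Fin N) → ℝ,
        ContDiffOn ℝ 1 w {0}ᶜ ∧
        MemBeppoLeviOrlicz Φ (Metric.closedBall 0 r)ᶜ w ∧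
        SolvesNegPhiLaplace Φ {0}ᶜ w (fun x => ν * ‖x‖ ^ (-l)) ∧
        (∀ x, ‖x‖ = r → w x = c) ∧
        Tendsto w (cocompact (EuclideanSpace ℝ (Fin N))) (𝓝 0) ∧
        ∃ k : ℝ, 0 < k ∧
          (∀ x, x ≠ 0 → IntegrableOn (radialIntegrand N Φ l ν k) (Ioi ‖x‖) ∧
            w x = ∫ ρ in Ioi ‖x‖, radialIntegrand N Φ l ν k ρ) ∧
          (∀ k' : ℝ, 0 < k' → ∫ ρ in Ioi r, radialIntegrand N Φ l ν k' ρ = c → k' = k) := by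
  intro ν hν
  set F : ℝ → ℝ := fun k => ∫ ρ in Ioi r, radialIntegrand N Φ l ν k ρ
  have hF0 : F 0 < c := by
    have hsub : μ / (l - N) = -μ / (N - l) := by rw [← neg_sub, div_neg, neg_div]
    rcases hν with rfl | rfl
    · refine lt_of_le_of_lt (setIntegral_nonpos measurableSet_Ioi fun ρ hρ => ?_) hc
      have hρ0 : 0 < ρ := hr.trans hρ
      refine (hΦ.strictMono_phiInv.monotone ?_).trans_eq hΦ.phiInv_zero
      rw [zero_mul, add_zero]
      exact mul_nonpos_of_nonpos_of_nonneg (div_nonpos_of_nonneg_of_nonpos hμ.le (by linarith))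
        (by positivity)
    · refine lt_of_eq_of_lt ?_ hthr
      simp only [F, radialIntegrand, zero_mul, add_zero, hsub]
  obtain ⟨K, hK, hFK⟩ := hΦ.exists_lt_boundaryValue hl hr hc ν
  obtain ⟨k, hk, hFk⟩ := intermediate_value_Ioo hK.le
    (hΦ.continuous_boundaryValue hl hr ν).continuousOn ⟨hF0, hFK⟩
  have hcont := hΦ.continuousOn_radialIntegrand l ν k
  have hint := fun (a : ℝ) (ha : 0 < a) => hΦ.integrableOn_radialIntegrand hl ha ν k
  have hcont' : ∀ a : ℝ, 0 < a → ContinuousOn (radialIntegrand N Φ l ν k) (Ioi a) := fun a ha =>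
    hcont.mono (Ioi_subset_Ioi ha.le)
  refine ⟨fun x => ∫ ρ in Ioi ‖x‖, radialIntegrand N Φ l ν k ρ, ?_, ?_, ?_, ?_, ?_, k, hk.1, ?_, ?_⟩
  · intro x hx
    have hn : 0 < ‖x‖ := norm_pos_iff.2 hx
    have h1 := contDiffOn_comp_norm (N := N) (half_pos hn).le
      (contDiffOn_integral_Ioi (hcont' _ (half_pos hn)) (hint _ (half_pos hn)))
    exact (h1.contDiffAt ((isOpen_lt continuous_const continuous_norm).mem_nhds
      (half_lt_self hn))).contDiffWithinAt
  · have hk' : |k| ≤ k := (abs_of_pos hk.1).le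
    have hB : 0 < |ν / (N - l)| * r ^ ((N : ℝ) - l) + k := by have := hk.1; positivity
    have hpos : ∀ ρ, r ≤ ρ → 0 < (|ν / (N - l)| * r ^ ((N : ℝ) - l) + k) * ρ ^ (1 - (N : ℝ)) :=
      fun ρ hρ => mul_pos hB (Real.rpow_pos_of_pos (hr.trans_le hρ) _)
    refine hΦ.memBeppoLeviOrlicz_radial hr (hcont.mono fun ρ hρ => hr.trans_le hρ) ?_
      (fun ρ hρ => hΦ.phiInv_pos (hpos ρ hρ))
      (fun ρ hρ => hΦ.abs_radialIntegrand_le hl hr hρ hk' ν)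
      (hΦ.integrableOn_phiInv_rpow hB hr) (hΦ.lintegral_phiInv_rpow_lt_top hB hr)
    exact hΦ.continuous_phiInv.comp_continuousOn (continuousOn_const.mul
      (continuousOn_id.rpow_const fun ρ hρ => Or.inl (hr.trans_le hρ).ne'))
  · refine hΦ.solvesNegPhiLaplace_radial hl (k := k) fun x hx => ?_
    have hn : 0 < ‖x‖ := norm_pos_iff.2 hx
    exact hasGradientAt_comp_norm hx (hasDerivAt_integral_Ioi (hcont' _ (half_pos hn))
      (hint _ (half_pos hn)) (half_lt_self hn))
  · intro x hx
    simp only [hx]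
    exact hFk
  · refine Tendsto.comp (g := fun t => ∫ ρ in Ioi t, radialIntegrand N Φ l ν k ρ) ?_
      (tendsto_norm_cocompact_atTop (E := EuclideanSpace ℝ (Fin N)))
    have h1 := intervalIntegral_tendsto_integral_Ioi r (hint r hr) tendsto_id
    have h2 := h1.const_sub (∫ ρ in Ioi r, radialIntegrand N Φ l ν k ρ)
    rw [sub_self] at h2
    refine h2.congr' ?_
    filter_upwards [eventually_ge_atTop r] with t ht
    have := intervalIntegral.integral_Ioi_sub_Ioi (hint r hr) ht
    simp only [id]
    linarith
  · exact fun x hx => ⟨hint _ (norm_pos_iff.2 hx), rfl⟩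
  · exact fun k' _ hk' => (hΦ.strictMono_boundaryValue hl hr ν).injective (hk'.trans hFk.symm)
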